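/- Let $d,e,r$ be positive integers with $e\mid r$, let $\mathcal U_{de}$ be the group of complex $de$-th roots of unity, let $\zeta$ be a generator of $\mathcal U_{de}$, and let $G(de,1,r)=\mathcal U_{de}^r\rtimes\mathfrak S_r$, with elements $(z;\sigma)$. Let $\varepsilon$ be the linear character $\varepsilon(z;\sigma)=(z_1\cdots z_r)^d$ of $G(de,1,r)$ and $G(de,e,r)=\ker\varepsilon$. Let $\mathfrak g\in G(de,1,r)$ be an element with $\varepsilon(\mathfrak g)=\zeta^d$. For a $de$-multipartition $\underline\eta=(\eta_0,\dots,\eta_{de-1})$ of $r$, list its parts in some order as $\ell_1,\dots,\ell_s$, where $\ell_j$ is a part of $\eta_{u_j}$; put $L_j=\ell_1+\cdots+\ell_{j-1}$ and $g_{\underline\eta}=(z;\sigma_1\cdots\sigma_s)$ with $\sigma_j=(L_j+1\ \cdots\ L_j+\ell_j)$, $z_{L_j+1}=\zeta^{u_j}$ for $1\le j\le s$, and all other $z_k$ equal to $1$. For a divisor $q$ of $e$, let $\mathcal P_{r,de,q}$ be the set of $de$-multipartitions $\underline\eta$ of $r$ such that $\eta_u=\emptyset$ unless $q\mid u$, and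 all parts of all $\eta_u$ are divisible by $q$. Put $g_{\underline\eta,j}=\mathfrak g^j g_{\underline\eta}\,\mathfrak g^{-j}$. Then the elements $g_{\underline\eta,j}$ that lie in $G(de,e,r)$, where $(\underline\eta,j)$ runs over $$\bigcup_{q\mid e}\{(\underline\eta,j)\mid \underline\eta\in\mathcal P_{r,de,q},\ 0\le j\le q-1\},$$ are pairwise distinct and form a complete system of representatives of the conjugacy classes of $G(de,e,r)$. -/

import Mathlib

namespace ReflectionGroup

/-- The group `G(n,1,r) = U_n ≀ S_r = U_n ^ r ⋊ S_r`, where `U_n` is the group of complex `n`-th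
roots of unity. A permutation `σ` acts on `U_n ^ r` by `(σ • z) i = z (σ⁻¹ i)`, so that
`σ⁻¹ (z₁, …, z_r) σ = (z_{σ 1}, …, z_{σ r})`. -/
abbrev Wreath (n r : ℕ) : Type :=
  (Fin r → rootsOfUnity n ℂ) ⋊[mulAutArrow] Equiv.Perm (Fin r)

/-- The linear character `ε (z; σ) = (z₁ ⋯ z_r) ^ d` of `G(de,1,r)`, with values in `U_{de}`. -/
def eps (d e r : ℕ) : Wreath (d * e) r →* rootsOfUnity (d * e) ℂ where
  toFun x := (∏ i, x.left i) ^ d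
  map_one' := by simp
  map_mul' x y := by
    have h : ∏ i, (mulAutArrow x.right y.left) i = ∏ i, y.left i :=
      Equiv.prod_comp (x.right⁻¹ : Equiv.Perm (Fin r)) y.left
    rw [SemidirectProduct.mul_left, ← mul_pow, ← h, ← Finset.prod_mul_distrib]
    rfl

/-- The group `G(de,e,r)`: the kernel of `ε` in `G(de,1,r)`, that is the `(z; σ)` for which
`z₁ ⋯ z_r` lies in `U_d`. -/
def G (d e r : ℕ) : Subgroup (Wreath (d * e) r) := (eps d e r).ker

/-- An `n`-multipartition of `r`: a tuple `(η_0, …, η_{n-1})` of partitions, each given by the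
multiset of its (positive) parts, of total size `r`. -/
@[ext]
structure Multipartition (n r : ℕ) where
  /-- The parts of the `u`-th partition. -/
  parts : Fin n → Multiset ℕ
  pos : ∀ u, ∀ k ∈ parts u, 0 < k
  sum_eq : ∑ u, (parts u).sum = r

/-- A list of pairs `(ℓ_1, u_1), …, (ℓ_s, u_s)` with `ℓ_j ≥ 1`, `ℓ_1 + ⋯ + ℓ_s = r` and
`0 ≤ u_j < n`: the composition `ℓ` of `r` together with a colour `u_j` for each block. -/
structure ColoredComposition (n r : ℕ) where
  /-- The composition `(ℓ_1, …, ℓ_s)` of `r`. -/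
  comp : Composition r
  /-- The colours `u_1, …, u_s`. -/
  color : Fin comp.length → Fin n

namespace ColoredComposition

variable {n r : ℕ}

/-- `c` lists the parts of `η`, in some order: for each `u`, the parts of `η_u` are the `ℓ_j`
with `u_j = u`, counted with multiplicity. -/
def Lists (c : ColoredComposition n r) (η : Multipartition n r) : Prop :=
  ∀ u : Fin n, η.parts u = (Finset.univ.filter fun j => c.color j = u).val.map c.comp.blocksFun

/-- The product of the cycles `σ_j = (L_j + 1, L_j + 2, …, L_j + ℓ_j)`, where
`L_j = ℓ_1 + ⋯ + ℓ_{j-1}`. -/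
def perm (c : ColoredComposition n r) : Equiv.Perm (Fin r) :=
  c.comp.blocksFinEquiv.permCongr (Equiv.sigmaCongrRight fun j => finRotate (c.comp.blocksFun j))

/-- The element `(z; σ)` of `G(n,1,r)` with `σ = σ_1 ⋯ σ_s` as above, `z_{L_j + 1} = ζ ^ u_j`
for all `j`, and all other entries of `z` equal to `1`. -/
def elt (ζ : rootsOfUnity n ℂ) (c : ColoredComposition n r) : Wreath n r where
  left k := if (c.comp.invEmbedding k : ℕ) = 0 then ζ ^ (c.color (c.comp.index k) : ℕ) else 1
  right := c.perm

end ColoredComposition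

/-- The set `P_{r,n,q}` of the `n`-multipartitions `η` of `r` such that `η_u` is empty unless
`q` divides `u`, and all parts of all `η_u` are divisible by `q`. -/
def divisibleMultipartitions (n r q : ℕ) : Set (Multipartition n r) :=
  {η | (∀ u : Fin n, ¬ q ∣ (u : ℕ) → η.parts u = 0) ∧ ∀ u, ∀ k ∈ η.parts u, q ∣ k}

/-- The labels `(η, j)` with `η ∈ P_{r,de,q}` and `0 ≤ j ≤ q - 1` for some divisor `q` of `e`. -/
def classLabels (d e r : ℕ) : Set (Multipartition (d * e) r × ℕ) :=
  {p | ∃ q, q ∣ e ∧ p.1 ∈ divisibleMultipartitions (d * e) r q ∧ p.2 < q}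

/-- The element `g_{η,j} = x ^ j g_η x ^ (-j)` for `p = (η, j)`, where `g_η` is the element attached
to `η` and to the order `c η` in which the parts of `η` are listed. -/
def classElt {n r : ℕ} (ζ : rootsOfUnity n ℂ) (c : Multipartition n r → ColoredComposition n r)
    (x : Wreath n r) (p : Multipartition n r × ℕ) : Wreath n r :=
  x ^ p.2 * (c p.1).elt ζ * (x ^ p.2)⁻¹

end ReflectionGroup

namespace ReflectionGroup

open Equiv.Perm

/-! Conjugacy in `G(de,1,r)` is decided by the cycle lengths together with the products of the
entries along each cycle, so `η ↦ g_η` parametrizes its classes (`exists_conj_elt`,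
`eq_of_conj_elt`). Such a class splits under `ker ε` according to the cosets of `ε(C)` in the image
of `ε`, where `C` is the centralizer of `g_η`. All values of `ε` are powers of `ζ ^ d`, which has
order `e`. There is `Q ∣ e` with `η ∈ P_Q` and `ε(C) = ⟨ζ ^ (dQ)⟩`: `exists_commute_elt` gives `Q`
and one inclusion, `dvd_of_commute_elt` the other. Every `q ∣ e` with `η ∈ P_q` satisfies `q ≤ Q`,
so the labels over `η` are exactly `0 ≤ j < Q`, one for each coset. -/

theorem val_finRotate {m : ℕ} (k : Fin m) : (finRotate m k : ℕ) = (k + 1) % m := by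
  cases m with
  | zero => exact k.elim0
  | succ m => rw [finRotate_apply, Fin.val_add]; simp

/-! ### Block forms and conjugacy in wreath products. -/

section Generic

variable {ι A : Type} [CommGroup A]

/-- The equation `c x = y c` in a wreath product, in coordinates. -/
theorem mul_eq_mul_iff {c x y : (ι → A) ⋊[mulAutArrow] Equiv.Perm ι} :
    c * x = y * c ↔ (∀ i, c.right (x.right i) = y.right (c.right i)) ∧
      ∀ i, c.left (c.right (x.right i)) * x.left (x.right i) =
        y.left (y.right (c.right i)) * c.left (c.right i) := by
  have hl : ∀ (a b : (ι → A) ⋊[mulAutArrow] Equiv.Perm ι) (i : ι),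
      (a * b).left (a.right i) = a.left (a.right i) * b.left i := by
    intro a b i
    change a.left (a.right i) * b.left (a.right⁻¹ (a.right i)) = _
    simp
  constructor
  · intro h
    have hr : ∀ i, c.right (x.right i) = y.right (c.right i) := fun i =>
      congrArg (fun z : (ι → A) ⋊[mulAutArrow] Equiv.Perm ι => z.right i) h
    refine ⟨hr, fun i => ?_⟩
    rw [← hl, h, hr, hl]
  · rintro ⟨hr, h⟩
    refine SemidirectProduct.ext ?_ (Equiv.ext hr)
    funext k
    obtain ⟨i, rfl⟩ : ∃ i, c.right (x.right i) = k :=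
      ⟨x.right⁻¹ (c.right⁻¹ k), by simp⟩
    rw [hl, h, hr, hl]

variable {J : Type} {ℓ : J → ℕ}

/-- `τ` is carried by `E` to the product of the rotations of the blocks `Fin (ℓ j)`. -/
def HasCycles (E : (Σ j, Fin (ℓ j)) ≃ ι) (τ : Equiv.Perm ι) : Prop :=
  ∀ j k, τ (E ⟨j, k⟩) = E ⟨j, finRotate _ k⟩

/-- `x` permutes the blocks cyclically, and its label is `a j` at the start of the
`j`-th block and trivial elsewhere. -/
structure IsBlockForm (E : (Σ j, Fin (ℓ j)) ≃ ι) (a : J → A)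
    (x : (ι → A) ⋊[mulAutArrow] Equiv.Perm ι) : Prop where
  right : HasCycles E x.right
  left : ∀ j k, x.left (E ⟨j, k⟩) = if (k : ℕ) = 0 then a j else 1

/-- The blocks are the orbits of `τ`; each is enumerated by iterating `τ` on a chosen representative
up to its minimal period. -/
theorem exists_hasCycles [Finite ι] (τ : Equiv.Perm ι) :
    ∃ (J : Type) (_ : Fintype J) (ℓ : J → ℕ) (E : (Σ j, Fin (ℓ j)) ≃ ι),
      (∀ j, 0 < ℓ j) ∧ HasCycles E τ := by
  classical
  let S := SameCycle.setoid τ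
  let ℓ : Quotient S → ℕ := fun j => Function.minimalPeriod τ j.out
  have hpos : ∀ j, 0 < ℓ j := fun j =>
    Function.minimalPeriod_pos_of_mem_periodicPts
      (Function.Injective.mem_periodicPts τ.injective j.out)
  let F : (Σ j, Fin (ℓ j)) → ι := fun p => τ^[p.2] p.1.out
  have hF : ∀ p, SameCycle τ p.1.out (F p) := fun p =>
    ⟨p.2, by simp [F, Equiv.Perm.iterate_eq_pow]⟩
  have hinj : Function.Injective F := by
    rintro ⟨j, k⟩ ⟨j', k'⟩ h
    have hj : j = j' := by
      rw [← Quotient.out_eq j, ← Quotient.out_eq j']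
      exact Quotient.sound (((hF ⟨j, k⟩).trans (h ▸ SameCycle.refl _ _)).trans (hF ⟨j', k'⟩).symm)
    subst hj
    have := Function.iterate_injOn_Iio_minimalPeriod (f := τ) (x := j.out) k.2 k'.2 h
    rw [Fin.ext this]
  have hsurj : Function.Surjective F := by
    intro i
    have h : SameCycle τ (Quotient.mk S i).out i := Quotient.exact (s := S) (Quotient.out_eq _)
    obtain ⟨m, hm⟩ := h.exists_nat_pow_eq
    refine ⟨⟨Quotient.mk S i, ⟨m % ℓ _, Nat.mod_lt _ (hpos _)⟩⟩, ?_⟩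
    change τ^[m % Function.minimalPeriod τ _] _ = i
    rw [Function.iterate_mod_minimalPeriod_eq, Equiv.Perm.iterate_eq_pow, hm]
  refine ⟨Quotient S, Fintype.ofFinite _, ℓ, Equiv.ofBijective F ⟨hinj, hsurj⟩, hpos, ?_⟩
  intro j k
  change τ (τ^[k] j.out) = τ^[(finRotate _ k : ℕ)] j.out
  rw [val_finRotate, Function.iterate_mod_minimalPeriod_eq, Function.iterate_succ_apply']

/-- Conjugation by a diagonal element moves all entries of a cycle to its first position; `a j` is
the product along the cycle. -/
theorem HasCycles.exists_isBlockForm {E : (Σ j, Fin (ℓ j)) ≃ ι}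
    {x : (ι → A) ⋊[mulAutArrow] Equiv.Perm ι} (h : HasCycles E x.right) :
    ∃ (a : J → A) (c y : (ι → A) ⋊[mulAutArrow] Equiv.Perm ι),
      IsBlockForm E a y ∧ c * x = y * c := by
  let W : J → ℕ → A := fun j m => if hm : m < ℓ j then x.left (E ⟨j, ⟨m, hm⟩⟩) else 1
  have hW : ∀ j (k : Fin (ℓ j)), x.left (E ⟨j, k⟩) = W j k := fun j k => by simp [W]
  let a : J → A := fun j => ∏ m ∈ Finset.range (ℓ j), W j m
  -- The partial products start at index 1, so the equation telescopes inside a block and leaves the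
  -- full product at the wrap-around.
  let T : (Σ j, Fin (ℓ j)) → A := fun p => (∏ m ∈ Finset.range p.2, W p.1 (m + 1))⁻¹
  let B : (Σ j, Fin (ℓ j)) → A := fun p => if (p.2 : ℕ) = 0 then a p.1 else 1
  refine ⟨a, ⟨fun i => T (E.symm i), 1⟩, ⟨fun i => B (E.symm i), x.right⟩,
    ⟨h, fun j k => congrArg B (E.symm_apply_apply _)⟩, ?_⟩
  rw [mul_eq_mul_iff]
  refine ⟨fun i => rfl, fun i => ?_⟩
  obtain ⟨⟨j, k⟩, rfl⟩ := E.surjective i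
  change T (E.symm (x.right _)) * x.left (x.right _) = B (E.symm (x.right (E _))) * T (E.symm (E _))
  rw [h j k, hW, E.symm_apply_apply, E.symm_apply_apply]
  simp only [T, B, val_finRotate]
  rcases Nat.lt_or_ge (k + 1) (ℓ j) with hk | hk
  · rw [Nat.mod_eq_of_lt hk, Finset.prod_range_succ]
    simp
  · have hk' : (k : ℕ) + 1 = ℓ j := le_antisymm k.2 hk
    have hmod : ((k : ℕ) + 1) % ℓ j = 0 := by rw [hk', Nat.mod_self]
    rw [hmod, if_pos rfl]
    have ha : a j = ∏ m ∈ Finset.range (k + 1), W j m := by rw [hk']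
    rw [ha, Finset.prod_range_succ']
    simp

theorem IsBlockForm.exists_conj {J' : Type} {ℓ' : J' → ℕ} {E : (Σ j, Fin (ℓ j)) ≃ ι}
    {E' : (Σ j, Fin (ℓ' j)) ≃ ι} {a : J → A} {a' : J' → A}
    {x y : (ι → A) ⋊[mulAutArrow] Equiv.Perm ι} (hx : IsBlockForm E a x)
    (hy : IsBlockForm E' a' y) (f : J ≃ J') (hℓ : ∀ j, ℓ' (f j) = ℓ j)
    (ha : ∀ j, a' (f j) = a j) : ∃ c, c * x = y * c := by
  -- Making the lengths equal by substitution lets `f` carry blocks to blocks with no casts in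
  -- `Fin`.
  obtain rfl : (fun j => ℓ' (f j)) = ℓ := funext hℓ
  let ρ : Equiv.Perm ι := E.symm.trans ((Equiv.sigmaCongrLeft (β := fun j => Fin (ℓ' j)) f).trans E')
  have hρ : ∀ j k, ρ (E ⟨j, k⟩) = E' ⟨f j, k⟩ := fun j k => by
    simp [ρ, Equiv.sigmaCongrLeft]
  refine ⟨⟨1, ρ⟩, mul_eq_mul_iff.2 ?_⟩
  have key : ∀ i, ρ (x.right i) = y.right (ρ i) := by
    intro i
    obtain ⟨⟨j, k⟩, rfl⟩ := E.surjective i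
    rw [hx.right, hρ, hρ, hy.right]
  refine ⟨key, fun i => ?_⟩
  obtain ⟨⟨j, k⟩, rfl⟩ := E.surjective i
  change 1 * x.left _ = y.left (y.right (ρ _)) * 1
  rw [one_mul, mul_one, hx.right, hρ, hy.right, hx.left, hy.left, ha]

/-! ### Lengths and products of cycles as conjugacy invariants. -/

section Label

variable [Fintype ι]

open Classical in
/-- The length of the cycle of `i` and the product of the entries along it. -/
noncomputable def cycleLabel (x : (ι → A) ⋊[mulAutArrow] Equiv.Perm ι) (i : ι) : ℕ × A :=
  (∑ k, if SameCycle x.right i k then 1 else 0, ∏ k, if SameCycle x.right i k then x.left k else 1)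

/-- Conjugation multiplies each entry by a quotient of entries of `c` at consecutive points, and
these cancel around a cycle since `A` is commutative. -/
theorem cycleLabel_conj {c x y : (ι → A) ⋊[mulAutArrow] Equiv.Perm ι} (h : c * x = y * c) (i : ι) :
    cycleLabel y (c.right i) = cycleLabel x i := by
  classical
  obtain ⟨hr, hl⟩ := mul_eq_mul_iff.1 h
  have hy : y.right = c.right * x.right * c.right⁻¹ := by
    ext i; simp [hr]
  have hs : ∀ k, SameCycle y.right (c.right i) (c.right k) ↔ SameCycle x.right i k := fun k => by
    rw [hy, sameCycle_conj]; simp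
  have hc : ∀ k, y.left (c.right (x.right k)) =
      c.left (c.right (x.right k)) * x.left (x.right k) * (c.left (c.right k))⁻¹ := fun k => by
    rw [hr, eq_mul_inv_iff_mul_eq, ← hl, hr]
  refine Prod.ext ?_ ?_
  · change ∑ k, _ = ∑ k, _
    rw [← Equiv.sum_comp c.right]
    simp only [hs]
  · change ∏ k, _ = ∏ k, _
    rw [← Equiv.prod_comp c.right]
    simp only [hs]
    have e1 : (∏ k, if SameCycle x.right i k then y.left (c.right k) else 1) =
        ∏ k, ((if SameCycle x.right i k then c.left (c.right k) else 1) *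
          (if SameCycle x.right i k then x.left k else 1)) *
          (if SameCycle x.right i k then c.left (c.right (x.right⁻¹ k)) else 1)⁻¹ := by
      refine Finset.prod_congr rfl fun k _ => ?_
      have := hc (x.right⁻¹ k)
      rw [show x.right (x.right⁻¹ k) = k from x.right.apply_symm_apply k] at this
      split_ifs
      · exact this
      · simp
    have e2 : (∏ k, if SameCycle x.right i k then c.left (c.right (x.right⁻¹ k)) else 1) =
        ∏ k, if SameCycle x.right i k then c.left (c.right k) else 1 := by
      rw [← Equiv.prod_comp x.right]
      simp [sameCycle_apply_right]
    rw [e1, Finset.prod_mul_distrib, Finset.prod_mul_distrib, Finset.prod_inv_distrib, e2]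
    rw [mul_comm, inv_mul_cancel_left]

theorem HasCycles.sameCycle_iff {E : (Σ j, Fin (ℓ j)) ≃ ι} {τ : Equiv.Perm ι}
    (h : HasCycles E τ) {j j' : J} {k : Fin (ℓ j)} {k' : Fin (ℓ j')} :
    SameCycle τ (E ⟨j, k⟩) (E ⟨j', k'⟩) ↔ j = j' := by
  constructor
  · intro hs
    obtain ⟨m, hm⟩ := hs.exists_nat_pow_eq
    have : ∀ m : ℕ, (E.symm ((τ ^ m) (E ⟨j, k⟩))).1 = j := by
      intro m
      induction m with
      | zero => simp
      | succ m ih =>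
        rw [pow_succ', Equiv.Perm.mul_apply]
        obtain ⟨⟨j₁, k₁⟩, hk⟩ := E.surjective ((τ ^ m) (E ⟨j, k⟩))
        rw [← hk] at ih ⊢
        rw [h]
        simpa using ih
    have := this m
    rw [hm] at this
    simpa using this.symm
  · rintro rfl
    have h0 : 0 < ℓ j := k.pos
    have key : ∀ m (hm : m < ℓ j), SameCycle τ (E ⟨j, ⟨0, h0⟩⟩) (E ⟨j, ⟨m, hm⟩⟩) := by
      intro m
      induction m with
      | zero => intro _; exact SameCycle.refl _ _
      | succ m ih =>
        intro hm
        have := h j ⟨m, by omega⟩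
        have e : finRotate _ (⟨m, by omega⟩ : Fin (ℓ j)) = ⟨m + 1, hm⟩ :=
          Fin.ext (by rw [val_finRotate, Nat.mod_eq_of_lt hm])
        rw [← e, ← this, sameCycle_apply_right]
        exact ih _
    exact (key k k.2).symm.trans (key k' k'.2)

variable [Fintype J]

theorem prod_blocks {M : Type} [CommMonoid M] (E : (Σ j, Fin (ℓ j)) ≃ ι) (f : ι → M) :
    ∏ i, f i = ∏ j, ∏ k, f (E ⟨j, k⟩) := by
  rw [← Equiv.prod_comp E, Fintype.prod_sigma]

theorem IsBlockForm.cycleLabel_eq {E : (Σ j, Fin (ℓ j)) ≃ ι} {a : J → A}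
    {x : (ι → A) ⋊[mulAutArrow] Equiv.Perm ι} (hx : IsBlockForm E a x) (j : J) (k : Fin (ℓ j)) :
    cycleLabel x (E ⟨j, k⟩) = (ℓ j, a j) := by
  classical
  have h0 : 0 < ℓ j := k.pos
  refine Prod.ext ?_ ?_
  · change ∑ i, _ = ℓ j
    rw [← Equiv.sum_comp E, Fintype.sum_sigma]
    simp only [hx.right.sameCycle_iff]
    rw [Finset.sum_eq_single j (by intro b _ hb; simp [hb.symm]) (by simp)]
    simp
  · change ∏ i, _ = a j
    rw [prod_blocks E]
    simp only [hx.right.sameCycle_iff, hx.left]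
    rw [Finset.prod_eq_single j (by intro b _ hb; simp [hb.symm]) (by simp)]
    rw [Finset.prod_eq_single ⟨0, h0⟩]
    · simp
    · intro b _ hb
      rw [if_pos rfl, if_neg]
      exact fun h => hb (Fin.ext h)
    · simp

-- Counting points instead of blocks gives a number visibly invariant under conjugation; each block
-- with label `p` contributes `p.1` points.
open Classical in
theorem IsBlockForm.card_cycleLabel {E : (Σ j, Fin (ℓ j)) ≃ ι} {a : J → A}
    {x : (ι → A) ⋊[mulAutArrow] Equiv.Perm ι} (hx : IsBlockForm E a x) (p : ℕ × A) :
    (∑ i, if cycleLabel x i = p then 1 else 0) =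
      p.1 * (Finset.univ.filter fun j => (ℓ j, a j) = p).card := by
  rw [← Equiv.sum_comp E, Fintype.sum_sigma]
  simp only [hx.cycleLabel_eq]
  rw [Finset.card_filter, Finset.mul_sum]
  refine Finset.sum_congr rfl fun j _ => ?_
  by_cases h : (ℓ j, a j) = p
  · subst h; simp
  · simp [h]

open Classical in
theorem IsBlockForm.card_eq_of_conj {J' : Type} [Fintype J'] {ℓ' : J' → ℕ}
    {E : (Σ j, Fin (ℓ j)) ≃ ι} {E' : (Σ j, Fin (ℓ' j)) ≃ ι} {a : J → A} {a' : J' → A}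
    {c x y : (ι → A) ⋊[mulAutArrow] Equiv.Perm ι} (hx : IsBlockForm E a x)
    (hy : IsBlockForm E' a' y) (h : c * x = y * c) (p : ℕ × A) (hp : 0 < p.1) :
    (Finset.univ.filter fun j => (ℓ j, a j) = p).card =
      (Finset.univ.filter fun j => (ℓ' j, a' j) = p).card := by
  refine Nat.eq_of_mul_eq_mul_left hp ?_
  rw [← hx.card_cycleLabel, ← hy.card_cycleLabel,
    ← Equiv.sum_comp c.right fun i => if cycleLabel y i = p then 1 else 0]
  simp only [cycleLabel_conj h]

end Label

/-! ### Products of entries of centralizing elements. -/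

section Centralizer

variable [Fintype ι] [Fintype J] {E : (Σ j, Fin (ℓ j)) ≃ ι} {a : J → A}
  {x : (ι → A) ⋊[mulAutArrow] Equiv.Perm ι}

/-- Multiplication by `b` on the coordinates of the block `j` centralizes a block form. -/
theorem IsBlockForm.exists_commute_pow (hx : IsBlockForm E a x) (j : J) (b : A) :
    ∃ c : (ι → A) ⋊[mulAutArrow] Equiv.Perm ι, c * x = x * c ∧ ∏ i, c.left i = b ^ ℓ j := by
  classical
  refine ⟨⟨fun i => if (E.symm i).1 = j then b else 1, 1⟩, mul_eq_mul_iff.2 ⟨fun i => rfl, ?_⟩, ?_⟩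
  · intro i
    obtain ⟨⟨j, k⟩, rfl⟩ := E.surjective i
    simp [hx.right j k, mul_comm]
  · rw [prod_blocks E, Finset.prod_eq_single j (by intro b _ hb; simp [hb]) (by simp)]
    simp

/-- The `j`-th cycle of a block form, with its label, centralizes it. -/
theorem IsBlockForm.exists_commute_label (hx : IsBlockForm E a x) (j : J) (hj : 0 < ℓ j) :
    ∃ c : (ι → A) ⋊[mulAutArrow] Equiv.Perm ι, c * x = x * c ∧ ∏ i, c.left i = a j := by
  classical
  let σ : Equiv.Perm ι := E.permCongr (Equiv.sigmaCongrRight fun i =>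
    if i = j then finRotate (ℓ i) else 1)
  have hσ : ∀ i k, σ (E ⟨i, k⟩) = if i = j then E ⟨i, finRotate _ k⟩ else E ⟨i, k⟩ := by
    intro i k
    by_cases h : i = j <;> simp [σ, h]
  refine ⟨⟨fun i => if (E.symm i).1 = j then x.left i else 1, σ⟩, mul_eq_mul_iff.2 ⟨?_, ?_⟩, ?_⟩
  · intro i
    obtain ⟨⟨i, k⟩, rfl⟩ := E.surjective i
    change σ (x.right _) = x.right (σ _)
    by_cases h : i = j <;> simp [hx.right i, hσ, h]
  · intro i
    obtain ⟨⟨i, k⟩, rfl⟩ := E.surjective i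
    change (if (E.symm (σ (x.right _))).1 = j then x.left (σ (x.right _)) else 1) * _ =
      x.left (x.right (σ _)) * (if (E.symm (σ _)).1 = j then x.left (σ _) else 1)
    by_cases h : i = j <;> simp [hx.right i, hσ, h]
  · change (∏ i, if (E.symm i).1 = j then x.left i else 1) = a j
    rw [prod_blocks E, Finset.prod_eq_single j (by intro b _ hb; simp [hb]) (by simp)]
    rw [Finset.prod_eq_single ⟨0, hj⟩]
    · simp [hx.left]
    · intro b _ hb
      have : (b : ℕ) ≠ 0 := fun h => hb (Fin.ext h)
      simp [hx.left, this]
    · simp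

/-- If a subgroup contains the labels of a block form and the `ℓ j`-th powers, it contains
the products of the entries of the elements centralizing the block form. -/
theorem IsBlockForm.prod_mem_of_commute (hx : IsBlockForm E a x) (H : Subgroup A)
    (ha : ∀ j, a j ∈ H) (hℓ : ∀ j b, b ^ ℓ j ∈ H)
    {c : (ι → A) ⋊[mulAutArrow] Equiv.Perm ι} (hc : c * x = x * c) : ∏ i, c.left i ∈ H := by
  obtain ⟨hr, hl⟩ := mul_eq_mul_iff.1 hc
  have hxH : ∀ i, x.left i ∈ H := by
    intro i
    obtain ⟨⟨i, k⟩, rfl⟩ := E.surjective i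
    rw [hx.left]
    split_ifs
    exacts [ha _, H.one_mem]
  -- Modulo `H` the entries of `x` vanish, so those of `c` are constant along cycles, and each block
  -- contributes an `ℓ j`-th power.
  have hstep : ∀ i, (QuotientGroup.mk (c.left (x.right i)) : A ⧸ H) = c.left i := by
    intro i
    obtain ⟨i, rfl⟩ := c.right.surjective i
    have := congrArg (QuotientGroup.mk (s := H)) (hl i)
    rw [QuotientGroup.mk_mul, QuotientGroup.mk_mul, (QuotientGroup.eq_one_iff _).2 (hxH _),
      (QuotientGroup.eq_one_iff _).2 (hxH _), one_mul, mul_one, hr] at this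
    exact this
  have hconst : ∀ j (k k' : Fin (ℓ j)),
      (QuotientGroup.mk (c.left (E ⟨j, k⟩)) : A ⧸ H) = c.left (E ⟨j, k'⟩) := by
    intro j k k'
    obtain ⟨m, hm⟩ := (hx.right.sameCycle_iff (k := k) (k' := k')).2 rfl |>.exists_nat_pow_eq
    rw [← hm]
    clear hm
    induction m with
    | zero => simp
    | succ m ih => rw [ih, pow_succ', Equiv.Perm.mul_apply, hstep]
  rw [← QuotientGroup.eq_one_iff, prod_blocks E, ← QuotientGroup.mk'_apply, map_prod]
  refine Finset.prod_eq_one fun j _ => ?_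
  rw [map_prod]
  rcases Nat.eq_zero_or_pos (ℓ j) with h | h
  · exact Finset.prod_eq_one fun k _ => absurd k.2 (by omega)
  · simp only [QuotientGroup.mk'_apply]
    rw [Finset.prod_congr rfl fun k _ => hconst j k ⟨0, h⟩]
    simp only [Finset.prod_const, Finset.card_univ, Fintype.card_fin]
    rw [← QuotientGroup.mk_pow, QuotientGroup.eq_one_iff]
    exact hℓ _ _

end Centralizer

end Generic

end ReflectionGroup

namespace ReflectionGroup

/-! ### Multipartitions and the classes of `G(n,1,r)`. -/

section RootsOfUnity

variable {n r : ℕ} {ζ : rootsOfUnity n ℂ}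

theorem exists_pow_eq_of_rootsOfUnity (hn : 0 < n) (hζ : IsPrimitiveRoot ζ n)
    (b : rootsOfUnity n ℂ) : ∃ i < n, ζ ^ i = b := by
  have : NeZero n := ⟨hn.ne'⟩
  have h : IsPrimitiveRoot (ζ : ℂˣ) n := IsPrimitiveRoot.coe_submonoidClass_iff.2 hζ
  obtain ⟨i, hi, h⟩ := h.eq_pow_of_mem_rootsOfUnity b.2
  exact ⟨i, hi, Subtype.ext (by simpa using h)⟩

theorem ColoredComposition.elt_isBlockForm (c : ColoredComposition n r) :
    IsBlockForm c.comp.blocksFinEquiv (fun j => ζ ^ (c.color j : ℕ)) (c.elt ζ) where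
  right j k := by
    change c.comp.blocksFinEquiv _ = _
    simp
  left j k := by
    change (if (c.comp.invEmbedding (c.comp.embedding j k) : ℕ) = 0 then
      ζ ^ (c.color (c.comp.index (c.comp.embedding j k)) : ℕ) else 1) = _
    rw [c.comp.invEmbedding_comp, c.comp.index_embedding]

theorem ColoredComposition.Lists.count_eq {c : ColoredComposition n r} {η : Multipartition n r}
    (h : c.Lists η) (u : Fin n) (m : ℕ) :
    (η.parts u).count m =
      (Finset.univ.filter fun j => (c.comp.blocksFun j, c.color j) = (m, u)).card := by
  rw [h u, Multiset.count_map, ← Finset.filter_val, Finset.card_val, Finset.filter_filter]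
  congr 1
  ext j
  simp [and_comm, eq_comm]

theorem pow_color_eq_iff (hζ : IsPrimitiveRoot ζ n) {u v : Fin n} :
    ζ ^ (u : ℕ) = ζ ^ (v : ℕ) ↔ u = v :=
  ⟨fun h => Fin.ext (hζ.pow_inj u.2 v.2 h), fun h => h ▸ rfl⟩

theorem exists_conj_elt (hn : 0 < n) (hζ : IsPrimitiveRoot ζ n)
    {c : Multipartition n r → ColoredComposition n r} (hc : ∀ η, (c η).Lists η) (x : Wreath n r) :
    ∃ η h, h * x = (c η).elt ζ * h := by
  classical
  obtain ⟨J, _, ℓ, E, hpos, hE⟩ := exists_hasCycles x.right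
  obtain ⟨a, h, y, hy, hconj⟩ := hE.exists_isBlockForm
  choose v hv hva using fun j => exists_pow_eq_of_rootsOfUnity hn hζ (a j)
  let w : J → Fin n := fun j => ⟨v j, hv j⟩
  let η : Multipartition n r :=
    { parts := fun u => (Finset.univ.filter fun j => w j = u).val.map ℓ
      pos := by
        intro u k hk
        obtain ⟨j, -, rfl⟩ := Multiset.mem_map.1 hk
        exact hpos j
      sum_eq := by
        change ∑ u, ∑ j ∈ Finset.univ.filter (fun j => w j = u), ℓ j = r
        rw [Finset.sum_fiberwise]
        simpa using Fintype.card_congr E }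
  have hcount : ∀ p : ℕ × Fin n, (Finset.univ.filter fun j => (ℓ j, w j) = p).card =
      (Finset.univ.filter fun j => ((c η).comp.blocksFun j, (c η).color j) = p).card := by
    rintro ⟨m, u⟩
    rw [← (hc η).count_eq]
    change _ = Multiset.count m (Multiset.map ℓ _)
    rw [Multiset.count_map, ← Finset.filter_val, Finset.card_val, Finset.filter_filter]
    congr 1
    ext j
    simp [and_comm, eq_comm]
  have hequiv : ∀ p : ℕ × Fin n, Nonempty ({j // (ℓ j, w j) = p} ≃
      {j // ((c η).comp.blocksFun j, (c η).color j) = p}) := fun p =>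
    ⟨Fintype.equivOfCardEq (by simpa [Fintype.card_subtype] using hcount p)⟩
  -- Equal numbers of blocks for each length and colour glue to a bijection of blocks.
  let f := Equiv.ofFiberEquiv (f := fun j => (ℓ j, w j))
    (g := fun j => ((c η).comp.blocksFun j, (c η).color j)) fun p => (hequiv p).some
  have hf : ∀ j, ((c η).comp.blocksFun (f j), (c η).color (f j)) = (ℓ j, w j) :=
    fun j => Equiv.ofFiberEquiv_map (fun p => (hequiv p).some) j
  obtain ⟨h', hh'⟩ := hy.exists_conj ((c η).elt_isBlockForm (ζ := ζ)) f
    (fun j => congrArg Prod.fst (hf j)) (fun j =>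
      (congrArg (fun p => ζ ^ (p.2 : ℕ)) (hf j)).trans (hva j))
  exact ⟨η, h' * h, by rw [mul_assoc, hconj, ← mul_assoc, hh', mul_assoc]⟩

theorem eq_of_conj_elt (hζ : IsPrimitiveRoot ζ n) {c c' : ColoredComposition n r}
    {η η' : Multipartition n r} (hc : c.Lists η) (hc' : c'.Lists η') {h : Wreath n r}
    (hh : h * c.elt ζ = c'.elt ζ * h) : η = η' := by
  classical
  refine Multipartition.ext (funext fun u => Multiset.ext.2 fun m => ?_)
  -- Counting points cannot detect blocks of length 0; positivity of the parts excludes them.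
  rcases Nat.eq_zero_or_pos m with rfl | hm
  · rw [Multiset.count_eq_zero_of_notMem fun h => (η.pos u 0 h).ne rfl,
      Multiset.count_eq_zero_of_notMem fun h => (η'.pos u 0 h).ne rfl]
  · have := c.elt_isBlockForm.card_eq_of_conj c'.elt_isBlockForm hh (m, ζ ^ (u : ℕ)) hm
    simp only [Prod.mk.injEq, pow_color_eq_iff hζ] at this
    rw [hc.count_eq, hc'.count_eq]
    simpa only [Prod.mk.injEq] using this

theorem ColoredComposition.Lists.mem_divisibleMultipartitions_iff {c : ColoredComposition n r}
    {η : Multipartition n r} (h : c.Lists η) (q : ℕ) :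
    η ∈ divisibleMultipartitions n r q ↔
      ∀ j, q ∣ (c.color j : ℕ) ∧ q ∣ c.comp.blocksFun j := by
  have hmem : ∀ j, c.comp.blocksFun j ∈ η.parts (c.color j) := fun j => by
    rw [h]; exact Multiset.mem_map_of_mem _ (by simp)
  constructor
  · rintro ⟨h1, h2⟩ j
    refine ⟨?_, h2 _ _ (hmem j)⟩
    by_contra hq
    have := hmem j
    rw [h1 _ hq] at this
    simp at this
  · intro hq
    refine ⟨fun u hu => ?_, fun u k hk => ?_⟩
    · refine Multiset.eq_zero_of_forall_notMem fun k hk => ?_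
      rw [h u] at hk
      obtain ⟨j, hj, -⟩ := Multiset.mem_map.1 hk
      exact hu ((by simpa using hj : c.color j = u) ▸ (hq j).1)
    · rw [h u] at hk
      obtain ⟨j, -, rfl⟩ := Multiset.mem_map.1 hk
      exact (hq j).2

end RootsOfUnity

/-! ### Splitting of classes under the kernel of `ε`. -/

variable {d e r : ℕ} {ζ : rootsOfUnity (d * e) ℂ}

theorem zpow_pow_eq_zpow_iff (hd : 0 < d) (hζ : IsPrimitiveRoot ζ (d * e)) (i j : ℤ) :
    (ζ ^ d) ^ i = (ζ ^ d) ^ j ↔ (e : ℤ) ∣ i - j := by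
  have h : (ζ ^ d) ^ i = (ζ ^ d) ^ j ↔ ζ ^ ((d : ℤ) * (i - j)) = 1 := by
    rw [← mul_inv_eq_one, ← zpow_sub, ← zpow_natCast, ← zpow_mul]
  rw [h, hζ.zpow_eq_one_iff_dvd]
  push_cast
  exact mul_dvd_mul_iff_left (by exact_mod_cast hd.ne')

/-- The labels `ζ ^ u_j` and all `ℓ_j`-th powers lie in `⟨ζ ^ q⟩`, hence so does the product of the
entries of `y`. As `q ∣ e`, divisibility of `k` by `q` depends only on `(ζ ^ d) ^ k`. -/
theorem dvd_of_commute_elt (hd : 0 < d) (he : 0 < e) (hζ : IsPrimitiveRoot ζ (d * e))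
    {c : ColoredComposition (d * e) r} {η : Multipartition (d * e) r} (hc : c.Lists η) {q : ℕ}
    (hq : q ∣ e) (hη : η ∈ divisibleMultipartitions (d * e) r q) {y : Wreath (d * e) r}
    (hy : y * c.elt ζ = c.elt ζ * y) {k : ℤ} (hk : eps d e r y = (ζ ^ d) ^ k) : (q : ℤ) ∣ k := by
  rw [hc.mem_divisibleMultipartitions_iff] at hη
  have hmem : ∏ i, y.left i ∈ Subgroup.zpowers (ζ ^ q) := by
    refine c.elt_isBlockForm.prod_mem_of_commute _ (fun j => ?_) (fun j b => ?_) hy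
    · obtain ⟨m, hm⟩ := (hη j).1
      rw [hm, pow_mul]
      exact Subgroup.npow_mem_zpowers _ _
    · obtain ⟨m, hm⟩ := (hη j).2
      obtain ⟨i, -, rfl⟩ := exists_pow_eq_of_rootsOfUnity (Nat.mul_pos hd he) hζ b
      rw [hm, ← pow_mul, mul_left_comm, pow_mul]
      exact Subgroup.npow_mem_zpowers _ _
  obtain ⟨i, hi⟩ := Subgroup.mem_zpowers_iff.1 hmem
  have h1 : (ζ ^ d) ^ k = (ζ ^ d) ^ ((q : ℤ) * i) := by
    rw [← hk]
    change (∏ i, y.left i) ^ d = _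
    rw [← hi, zpow_mul, zpow_natCast, ← zpow_natCast, ← zpow_natCast, ← zpow_natCast,
      ← zpow_natCast, ← zpow_mul, ← zpow_mul, ← zpow_mul, ← zpow_mul]
    congr 1
    ring
  rw [zpow_pow_eq_zpow_iff hd hζ] at h1
  have h2 := (Int.natCast_dvd_natCast.2 hq).trans h1
  exact (dvd_iff_dvd_of_dvd_sub h2).2 (dvd_mul_right _ _)

theorem exists_commute_elt (hζ : IsPrimitiveRoot ζ (d * e)) (he : 0 < e)
    {c : ColoredComposition (d * e) r} {η : Multipartition (d * e) r} (hc : c.Lists η) :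
    ∃ q : ℕ, 0 < q ∧ q ∣ e ∧ η ∈ divisibleMultipartitions (d * e) r q ∧
      ∀ t : ℤ, ∃ y : Wreath (d * e) r,
        y * c.elt ζ = c.elt ζ * y ∧ eps d e r y = (ζ ^ d) ^ ((q : ℤ) * t) := by
  let S : Subgroup (rootsOfUnity (d * e) ℂ) :=
    (Subgroup.centralizer {c.elt ζ}).map (eps d e r)
  have hS : ∀ b, b ∈ S ↔ ∃ y : Wreath (d * e) r, y * c.elt ζ = c.elt ζ * y ∧ eps d e r y = b := by
    intro b
    simp [S, Subgroup.mem_map, Subgroup.mem_centralizer_singleton_iff, eq_comm]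
  -- The exponents of `ζ ^ d` realized on the centralizer form a subgroup of `ℤ` containing `e`; `q`
  -- is its nonnegative generator. A single labelled cycle realizes `u_j`, and the scalar `ζ` on a
  -- block realizes `ℓ_j`, so `q` divides both.
  let I : AddSubgroup ℤ :=
    { carrier := {k | (ζ ^ d) ^ k ∈ S}
      zero_mem' := by simp [S.one_mem]
      add_mem' := fun {a b} ha hb => by
        change (ζ ^ d) ^ (a + b) ∈ S
        rw [zpow_add]; exact S.mul_mem ha hb
      neg_mem' := fun {a} ha => by
        change (ζ ^ d) ^ (-a) ∈ S
        rw [zpow_neg]; exact S.inv_mem ha }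
  obtain ⟨a, ha⟩ := Int.subgroup_cyclic I
  have hI : ∀ k, k ∈ I ↔ (a.natAbs : ℤ) ∣ k := by
    intro k
    rw [ha, ← AddSubgroup.zmultiples_eq_closure, Int.mem_zmultiples_iff, Int.natAbs_dvd]
  have heI : (e : ℤ) ∈ I := by
    change (ζ ^ d) ^ (e : ℤ) ∈ S
    rw [zpow_natCast, ← pow_mul, hζ.pow_eq_one]
    exact S.one_mem
  have hae : a.natAbs ∣ e := Int.natCast_dvd_natCast.1 ((hI _).1 heI)
  refine ⟨a.natAbs, Nat.pos_of_dvd_of_pos hae he, hae, ?_, ?_⟩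
  · rw [hc.mem_divisibleMultipartitions_iff]
    intro j
    constructor
    · obtain ⟨y, hy, hy'⟩ := (c.elt_isBlockForm (ζ := ζ)).exists_commute_label j
        (c.comp.one_le_blocksFun j)
      refine Int.natCast_dvd_natCast.1 ((hI _).1 ((hS _).2 ⟨y, hy, ?_⟩))
      change (∏ i, y.left i) ^ d = _
      rw [hy', zpow_natCast, pow_right_comm]
    · obtain ⟨y, hy, hy'⟩ := (c.elt_isBlockForm (ζ := ζ)).exists_commute_pow j ζ
      refine Int.natCast_dvd_natCast.1 ((hI _).1 ((hS _).2 ⟨y, hy, ?_⟩))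
      change (∏ i, y.left i) ^ d = _
      rw [hy', zpow_natCast, pow_right_comm]
  · exact fun t => (hS _).1 ((hI _).2 (dvd_mul_right _ _))

theorem exists_eps_eq_zpow (hd : 0 < d) (he : 0 < e) (hζ : IsPrimitiveRoot ζ (d * e))
    (x : Wreath (d * e) r) : ∃ k : ℤ, eps d e r x = (ζ ^ d) ^ k := by
  obtain ⟨i, -, hi⟩ := exists_pow_eq_of_rootsOfUnity (Nat.mul_pos hd he) hζ (∏ i, x.left i)
  refine ⟨i, ?_⟩
  change (∏ i, x.left i) ^ d = _
  rw [← hi, zpow_natCast, pow_right_comm]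

/-- Labels of elements `g_{η,j}` that are conjugate under the kernel of `ε` agree. -/
theorem label_eq_of_conj (hd : 0 < d) (he : 0 < e) (hζ : IsPrimitiveRoot ζ (d * e))
    {c : Multipartition (d * e) r → ColoredComposition (d * e) r} (hc : ∀ η, (c η).Lists η)
    {g : Wreath (d * e) r} (hg : eps d e r g = ζ ^ d) {p p' : Multipartition (d * e) r × ℕ}
    (hp : p ∈ classLabels d e r) (hp' : p' ∈ classLabels d e r) {n : Wreath (d * e) r}
    (hn : eps d e r n = 1) (h : n * classElt ζ c g p = classElt ζ c g p' * n) : p = p' := by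
  obtain ⟨η, j⟩ := p
  obtain ⟨η', j'⟩ := p'
  have hconj : (g ^ j')⁻¹ * n * g ^ j * (c η).elt ζ = (c η').elt ζ * ((g ^ j')⁻¹ * n * g ^ j) := by
    simp only [classElt] at h
    calc (g ^ j')⁻¹ * n * g ^ j * (c η).elt ζ
        = (g ^ j')⁻¹ * (n * (g ^ j * (c η).elt ζ * (g ^ j)⁻¹)) * g ^ j := by group
      _ = _ := by rw [h]; group
  obtain rfl := eq_of_conj_elt hζ (hc η) (hc η') hconj
  obtain ⟨q, hq, hη, hj⟩ := hp
  obtain ⟨q', hq', hη', hj'⟩ := hp'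
  obtain ⟨Q, hQ, hQe, hηQ, hy⟩ := exists_commute_elt hζ he (hc η)
  obtain ⟨y, hy1, hy2⟩ := hy 1
  rw [mul_one] at hy2
  -- Both `j` and `j'` are thus below `Q`, while `hconj` is now a centralizing relation and forces
  -- `Q ∣ j - j'`.
  have hqQ := Nat.le_of_dvd hQ
    (Int.natCast_dvd_natCast.1 (dvd_of_commute_elt hd he hζ (hc η) hq hη hy1 hy2))
  have hqQ' := Nat.le_of_dvd hQ
    (Int.natCast_dvd_natCast.1 (dvd_of_commute_elt hd he hζ (hc η) hq' hη' hy1 hy2))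
  have hdvd : (Q : ℤ) ∣ (j : ℤ) - j' := by
    refine dvd_of_commute_elt hd he hζ (hc η) hQe hηQ hconj ?_
    rw [map_mul, map_mul, map_inv, map_pow, map_pow, hn, hg, mul_one, zpow_sub, zpow_natCast,
      zpow_natCast]
    exact mul_comm _ _
  simp only at hj hj'
  have hjj : j = j' := by
    have h0 : (j : ℤ) - j' = 0 := Int.eq_zero_of_abs_lt_dvd hdvd (by rw [abs_lt]; omega)
    omega
  rw [hjj]

end ReflectionGroup

theorem theorem3 (d e r : ℕ) (hd : 0 < d) (he : 0 < e) (hr : 0 < r) (her : e ∣ r)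
    -- a generator of the group of complex `de`-th roots of unity
    (ζ : rootsOfUnity (d * e) ℂ) (hζ : IsPrimitiveRoot ζ (d * e))
    -- for each `η`, the order in which its parts are listed in the definition of `g_η`
    (c : ReflectionGroup.Multipartition (d * e) r → ReflectionGroup.ColoredComposition (d * e) r)
    (hc : ∀ η, (c η).Lists η)
    -- an element of `G(de,1,r)` with `ε 𝔤 = ω = ζ ^ d`
    (𝔤 : ReflectionGroup.Wreath (d * e) r) (h𝔤 : ReflectionGroup.eps d e r 𝔤 = ζ ^ d) :
    -- distinct labels give distinct elements
    Set.InjOn (ReflectionGroup.classElt ζ c 𝔤)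
      {p | p ∈ ReflectionGroup.classLabels d e r ∧
        ReflectionGroup.classElt ζ c 𝔤 p ∈ ReflectionGroup.G d e r} ∧
    -- each conjugacy class of `G(de,e,r)` contains exactly one of the elements `g_{η,j}`
    Set.BijOn (ConjClasses.mk : ReflectionGroup.G d e r → ConjClasses (ReflectionGroup.G d e r))
      {x | (x : ReflectionGroup.Wreath (d * e) r) ∈
        ReflectionGroup.classElt ζ c 𝔤 '' ReflectionGroup.classLabels d e r}
      Set.univ := by
  open ReflectionGroup in
  refine ⟨?_, fun _ _ => Set.mem_univ _, ?_, ?_⟩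
  · rintro p ⟨hp, -⟩ p' ⟨hp', -⟩ h
    -- Equality is conjugacy by 1.
    exact label_eq_of_conj hd he hζ hc h𝔤 hp hp' (map_one _) (by rw [one_mul, mul_one, h])
  · rintro x ⟨p, hp, hx⟩ y ⟨p', hp', hy⟩ h
    obtain ⟨n, hn⟩ := isConj_iff.1 (ConjClasses.mk_eq_mk_iff_isConj.1 h)
    have hn' : (n : Wreath (d * e) r) * x = y * n := by
      rw [← hn]; simp
    rw [← hx, ← hy] at hn'
    obtain rfl := label_eq_of_conj hd he hζ hc h𝔤 hp hp' (n := n) n.2 hn'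
    exact Subtype.ext (hx.symm.trans hy)
  · intro C _
    obtain ⟨x, rfl⟩ := ConjClasses.exists_rep C
    obtain ⟨η, h, hh⟩ := exists_conj_elt (Nat.mul_pos hd he) hζ hc (x : Wreath (d * e) r)
    obtain ⟨q, hq, hqe, hη, hcomm⟩ := exists_commute_elt hζ he (hc η)
    obtain ⟨k, hk⟩ := exists_eps_eq_zpow hd he hζ h
    have hq0 : (q : ℤ) ≠ 0 := by exact_mod_cast hq.ne'
    -- Here `j` is the residue of `-k` modulo `q`; the centralizing `y` supplies the multiple `q *
    -- (-k / q)`, so that `𝔤 ^ j * y * h` has trivial `ε`.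
    obtain ⟨j, hj : _ = (j : ℤ)⟩ := Int.eq_ofNat_of_zero_le (Int.emod_nonneg (-k) hq0)
    have hjq : j < q := by
      have := Int.emod_lt_of_pos (-k) (by exact_mod_cast hq : (0 : ℤ) < q)
      omega
    obtain ⟨y, hy, hy'⟩ := hcomm ((-k) / q)
    let n : Wreath (d * e) r := 𝔤 ^ j * y * h
    have hn : n ∈ G d e r := by
      change eps d e r (𝔤 ^ j * y * h) = 1
      rw [map_mul, map_mul, map_pow, h𝔤, hy', hk, ← zpow_natCast (ζ ^ d) j, ← zpow_add,
        ← zpow_add]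
      have := Int.emod_add_mul_ediv (-k) q
      rw [show (j : ℤ) + q * ((-k) / q) + k = 0 by rw [← hj]; omega,
        zpow_zero]
    have hconj : n * x * n⁻¹ = classElt ζ c 𝔤 (η, j) := by
      rw [mul_inv_eq_iff_eq_mul]
      calc 𝔤 ^ j * y * h * x = 𝔤 ^ j * y * (h * x) := by rw [mul_assoc]
        _ = 𝔤 ^ j * (y * (c η).elt ζ) * h := by rw [hh]; simp only [mul_assoc]
        _ = 𝔤 ^ j * (c η).elt ζ * (𝔤 ^ j)⁻¹ * (𝔤 ^ j * y * h) := by rw [hy]; group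
    let n' : G d e r := ⟨n, hn⟩
    have hx : IsConj x (n' * x * n'⁻¹) := isConj_iff.2 ⟨n', rfl⟩
    exact ⟨n' * x * n'⁻¹, ⟨(η, j), ⟨q, hqe, hη, hjq⟩, hconj.symm⟩,
      ConjClasses.mk_eq_mk_iff_isConj.2 hx.symm⟩
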